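/- There exist absolute constants $c^*, C^*, p^* > 0$ such that the following holds. Let $M, n$ be positive integers with $M, n \ge C^*$ and $\log M \le c^* n$, and let $\sigma > 0$. For $\mathbf{f}\in\mathbb{R}^n$ let $\mathbb{P}_{\mathbf{f}}$ denote the law of $\mathbf{y} = \mathbf{f} + \boldsymbol{\xi}$, where $\boldsymbol{\xi}=(\xi_1,\dots,\xi_n)^T$ has i.i.d. $\mathcal{N}(0,\sigma^2)$ coordinates, and let $\|\cdot\|_2$ be the Euclidean norm. Then there exist vectors $\boldsymbol{b}_1,\dots,\boldsymbol{b}_M\in\mathbb{R}^n$ and orthoprojectors $A_1,\dots,A_M\in\mathbb{R}^{n\times n}$ of rank one (that is, $A_k = A_k^T = A_k^2$ and $\operatorname{rank} A_k = 1$) such that $$\inf_{\hat{\boldsymbol{\mu}}}\ \sup_{\mathbf{f}\in\mathbb{R}^n}\ \mathbb{P}_{\mathbf{f}}\Big(\|\hat{\boldsymbol{\mu}}-\mathbf{f}\|_2^2 - \min_{k=1,\dots,M}\|\boldsymbol{b}_k-\mathbf{f}\|_2^2 \ \ge\ c^*\sigma^2\log M\Big)\ \ge\ p^*,$$ $$\inf_{\hat{\boldsymbol{\mu}}}\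 \sup_{\mathbf{f}\in\mathbb{R}^n}\ \mathbb{P}_{\mathbf{f}}\Big(\|\hat{\boldsymbol{\mu}}-\mathbf{f}\|_2^2 - \min_{k=1,\dots,M}\|A_k\mathbf{y}-\mathbf{f}\|_2^2 \ \ge\ c^*\sigma^2\log M\Big)\ \ge\ p^*,$$ where the infima are taken over all estimators $\hat{\boldsymbol{\mu}}=\hat{\boldsymbol{\mu}}(\mathbf{y})$, i.e. all measurable maps $\mathbb{R}^n\to\mathbb{R}^n$. -/

import Mathlib

open MeasureTheory ProbabilityTheory

/-- An orthoprojector: a real square matrix `P` with `P = Pᵀ = P²`. -/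
def IsOrthoprojector {n : ℕ} (P : Matrix (Fin n) (Fin n) ℝ) : Prop :=
  P = P.transpose ∧ P.transpose = P ^ 2

/-- The image `A v` of a Euclidean vector `v` under a matrix `A`. -/
noncomputable def applyMatrix {n : ℕ} (A : Matrix (Fin n) (Fin n) ℝ)
    (v : EuclideanSpace ℝ (Fin n)) : EuclideanSpace ℝ (Fin n) :=
  WithLp.toLp 2 (A.mulVec v.ofLp)

/-- The law on `ℝⁿ` of the noise `ξ = (ξ₁, …, ξₙ)` with i.i.d. `N(0, σ²)` coordinates. -/
noncomputable def noiseLaw (n : ℕ) (σ : ℝ) : Measure (EuclideanSpace ℝ (Fin n)) :=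
  (Measure.pi (fun _ : Fin n => gaussianReal 0 (Real.toNNReal (σ ^ 2)))).map (WithLp.toLp 2)

/-- The law `ℙ_f` of the observation `y = f + ξ`. -/
noncomputable def obsLaw {n : ℕ} (σ : ℝ) (f : EuclideanSpace ℝ (Fin n)) :
    Measure (EuclideanSpace ℝ (Fin n)) :=
  (noiseLaw n σ).map (fun ξ => f + ξ)

/-- The minimax probability that the excess loss over a dictionary reaches the level `t`: the
infimum over all estimators `μ` (measurable functions of the observation `y`) of the supremum
over all `f ∈ ℝⁿ` of
`ℙ_f (‖μ(y) - f‖² - min_{k = 1, …, M} ‖dict k y - f‖² ≥ t)`.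
For `M ≥ 1` the real infimum over the finite type `Fin M` is a minimum. -/
noncomputable def minimaxExcessProb {n M : ℕ} (σ : ℝ)
    (dict : Fin M → EuclideanSpace ℝ (Fin n) → EuclideanSpace ℝ (Fin n)) (t : ℝ) : ENNReal :=
  ⨅ (μ : EuclideanSpace ℝ (Fin n) → EuclideanSpace ℝ (Fin n)) (_ : Measurable μ),
    ⨆ f : EuclideanSpace ℝ (Fin n),
      obsLaw σ f {y | t ≤ ‖μ y - f‖ ^ 2 - ⨅ k : Fin M, ‖dict k y - f‖ ^ 2}

/-!
The lower bounds come from testing `M` Gaussian shifts against each other. Take unit vectors `u k`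
with pairwise distances at least `1 / 4` and put `b k = r • u k` with `r ^ 2 = σ ^ 2 * log M` and
`A k` the orthoprojector onto the line through `u k`. Such unit vectors exist for
`log M ≤ c * n`, by comparing volumes of balls and of a spherical shell
(`exists_separated_unit_vectors`).

If the truth is `b k`, the dictionary element `b k` has loss zero, and the projection estimator
`A k y` has loss `⟪u k, ξ⟫ ^ 2`, which by Chebyshev's inequality rarely exceeds a multiple of
`σ ^ 2 * log M` once `log M` is large (`obsLaw_projection_loss_gt_le`). An estimator whose excess
loss is small would therefore, in both cases, be close to `b k`, hence tell the `b k` apart.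

That is impossible (`exists_obsLaw_le_of_disjoint`). The likelihood ratio of the law with mean
`b k` to the pure noise law is `exp ((⟪b k, y⟫ - ‖b k‖ ^ 2 / 2) / σ ^ 2)`
(`obsLaw_eq_withDensity`), so on the half-space `⟪b k, y⟫ ≤ ‖b k‖ ^ 2`, of probability at least
`1 / 2` under `b k`, it is at most `exp (‖b k‖ ^ 2 / (2 * σ ^ 2)) = √M`. Disjoint events `B k` that
all had probability above `3 / 4` under their own `b k` would thus each have pure noise probability
above `1 / (4 * √M)`; summing over `k` gives `√M / 4 ≤ 1`, which fails for `M > 16`.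
-/

open scoped ENNReal RealInnerProductSpace

/-! ### Change of measure for the Gaussian shift -/

/-- Densities multiply under products: reweighting each factor of a product of probability
measures reweights the product measure by the product of the weights. -/
theorem pi_withDensity_eq {ι : Type*} [Fintype ι] {α : ι → Type*} [∀ i, MeasurableSpace (α i)]
    (μ : ∀ i, Measure (α i)) [∀ i, IsProbabilityMeasure (μ i)]
    {f : ∀ i, α i → ℝ≥0∞} (hf : ∀ i, Measurable (f i))
    [∀ i, SigmaFinite ((μ i).withDensity (f i))] :
    Measure.pi (fun i => (μ i).withDensity (f i)) =
      (Measure.pi μ).withDensity (fun x => ∏ i, f i (x i)) := by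
  refine Measure.pi_eq fun s hs => ?_
  have hg : ∀ i, Measurable ((s i).indicator (f i)) := fun i => (hf i).indicator (hs i)
  rw [withDensity_apply _ (MeasurableSet.univ_pi hs),
    ← lintegral_indicator (MeasurableSet.univ_pi hs)]
  have hind : ∀ x : ∀ i, α i, (Set.univ.pi s).indicator (fun x => ∏ i, f i (x i)) x =
      ∏ i, (s i).indicator (f i) (x i) := by
    intro x
    by_cases hx : x ∈ Set.univ.pi s
    · rw [Set.indicator_of_mem hx]
      exact Finset.prod_congr rfl fun i _ => (Set.indicator_of_mem (hx i trivial) _).symm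
    · rw [Set.indicator_of_notMem hx]
      simp only [Set.mem_univ_pi, not_forall] at hx
      obtain ⟨i, hi⟩ := hx
      exact (Finset.prod_eq_zero (Finset.mem_univ i) (Set.indicator_of_notMem hi _)).symm
  simp_rw [hind]
  refine (lintegral_prod_eq_prod_lintegral_of_indepFun Finset.univ
    (fun i (x : ∀ i, α i) => (s i).indicator (f i) (x i))
    (iIndepFun_pi fun i => (hg i).aemeasurable)
    (fun i => (hg i).comp (measurable_pi_apply i))).trans ?_
  refine Finset.prod_congr rfl fun i _ => ?_
  rw [withDensity_apply _ (hs i), ← lintegral_indicator (hs i)]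
  exact (measurePreserving_eval μ i).lintegral_comp (hg i)

theorem gaussianReal_eq_withDensity_gaussianReal_zero (m : ℝ) {v : NNReal} (hv : v ≠ 0) :
    gaussianReal m v = (gaussianReal 0 v).withDensity
      (fun x => ENNReal.ofReal (Real.exp ((m * x - m ^ 2 / 2) / v))) := by
  rw [gaussianReal_of_var_ne_zero m hv, gaussianReal_of_var_ne_zero 0 hv,
    ← withDensity_mul _ (measurable_gaussianPDF 0 v) (by fun_prop)]
  congr 1
  ext x
  rw [Pi.mul_apply, gaussianPDF, gaussianPDF, ← ENNReal.ofReal_mul (gaussianPDFReal_nonneg _ _ _),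
    gaussianPDFReal, gaussianPDFReal, mul_assoc _ (Real.exp _), ← Real.exp_add]
  have hv' : (v : ℝ) ≠ 0 := by exact_mod_cast hv
  congr 3
  field_simp
  ring

instance isProbabilityMeasure_noiseLaw (n : ℕ) (σ : ℝ) : IsProbabilityMeasure (noiseLaw n σ) :=
  Measure.isProbabilityMeasure_map (by fun_prop)

instance isProbabilityMeasure_obsLaw {n : ℕ} (σ : ℝ) (f : EuclideanSpace ℝ (Fin n)) :
    IsProbabilityMeasure (obsLaw σ f) :=
  Measure.isProbabilityMeasure_map (by fun_prop)

theorem obsLaw_eq_map_pi {n : ℕ} (σ : ℝ) (f : EuclideanSpace ℝ (Fin n)) :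
    obsLaw σ f = (Measure.pi fun i => gaussianReal (f i) (Real.toNNReal (σ ^ 2))).map
      (WithLp.toLp 2) := by
  have h : (fun i => gaussianReal (f i) (Real.toNNReal (σ ^ 2))) =
      fun i => (gaussianReal 0 (Real.toNNReal (σ ^ 2))).map (fun x => f i + x) := by
    funext i
    rw [gaussianReal_map_const_add, zero_add]
  rw [h, ← Measure.pi_map_pi (fun i => by fun_prop), obsLaw, noiseLaw,
    Measure.map_map (by fun_prop) (by fun_prop), Measure.map_map (by fun_prop) (by fun_prop)]
  rfl

theorem obsLaw_eq_withDensity {n : ℕ} {σ : ℝ} (hσ : 0 < σ) (f : EuclideanSpace ℝ (Fin n)) :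
    obsLaw σ f = (noiseLaw n σ).withDensity
      (fun y => ENNReal.ofReal (Real.exp ((⟪f, y⟫ - ‖f‖ ^ 2 / 2) / σ ^ 2))) := by
  have hv : Real.toNNReal (σ ^ 2) ≠ 0 := by
    rw [Ne, Real.toNNReal_eq_zero, not_le]; positivity
  have hcoe : ((Real.toNNReal (σ ^ 2) : NNReal) : ℝ) = σ ^ 2 := Real.coe_toNNReal _ (sq_nonneg σ)
  have hprod : ∀ x : Fin n → ℝ,
      ∏ i, ENNReal.ofReal (Real.exp ((f i * x i - f i ^ 2 / 2) / (Real.toNNReal (σ ^ 2) : NNReal)))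
        = ENNReal.ofReal (Real.exp ((⟪f, WithLp.toLp 2 x⟫ - ‖f‖ ^ 2 / 2) / σ ^ 2)) := by
    intro x
    rw [← ENNReal.ofReal_prod_of_nonneg (fun i _ => (Real.exp_pos _).le), ← Real.exp_sum, hcoe,
      ← Finset.sum_div, Finset.sum_sub_distrib, ← Finset.sum_div, EuclideanSpace.real_norm_sq_eq,
      PiLp.inner_apply]
    simp [mul_comm]
  have hfam : (fun i => gaussianReal (f i) (Real.toNNReal (σ ^ 2))) =
      fun i => (gaussianReal 0 (Real.toNNReal (σ ^ 2))).withDensity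
        (fun x => ENNReal.ofReal (Real.exp ((f i * x - f i ^ 2 / 2) /
          (Real.toNNReal (σ ^ 2) : NNReal)))) :=
    funext fun i => gaussianReal_eq_withDensity_gaussianReal_zero (f i) hv
  have : ∀ i, SigmaFinite ((gaussianReal 0 (Real.toNNReal (σ ^ 2))).withDensity
        (fun x => ENNReal.ofReal (Real.exp ((f i * x - f i ^ 2 / 2) /
          (Real.toNNReal (σ ^ 2) : NNReal))))) := by
    intro i
    rw [← gaussianReal_eq_withDensity_gaussianReal_zero (f i) hv]
    infer_instance
  rw [obsLaw_eq_map_pi, hfam, pi_withDensity_eq _ (fun i => by fun_prop)]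
  simp_rw [hprod]
  ext s hs
  have hm : Measurable (WithLp.toLp 2 : (Fin n → ℝ) → EuclideanSpace ℝ (Fin n)) := by fun_prop
  rw [Measure.map_apply hm hs, withDensity_apply _ (hm hs), withDensity_apply _ hs, noiseLaw,
    setLIntegral_map hs (by fun_prop) hm]

/-! ### Linear functionals of the noise -/

theorem noiseLaw_eq_map_stdGaussian (n : ℕ) (σ : ℝ) :
    noiseLaw n σ = (stdGaussian (EuclideanSpace ℝ (Fin n))).map (fun x => σ • x) := by
  have h : (fun _ : Fin n => gaussianReal 0 (Real.toNNReal (σ ^ 2))) =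
      fun _ => (gaussianReal 0 1).map (fun x => σ * x) := by
    funext i
    rw [gaussianReal_map_const_mul]
    congr 1
    · simp
    · ext; simp [Real.coe_toNNReal _ (sq_nonneg σ)]
  rw [← map_pi_eq_stdGaussian, noiseLaw, h, ← Measure.pi_map_pi (fun i => by fun_prop),
    Measure.map_map (by fun_prop) (by fun_prop), Measure.map_map (by fun_prop) (by fun_prop)]
  rfl

theorem noiseLaw_map_neg (n : ℕ) (σ : ℝ) :
    (noiseLaw n σ).map (fun x => -x) = noiseLaw n σ := by
  have h := stdGaussian_map (LinearIsometryEquiv.neg ℝ (E := EuclideanSpace ℝ (Fin n)))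
  rw [noiseLaw_eq_map_stdGaussian, Measure.map_map (by fun_prop) (by fun_prop)]
  conv_rhs => rw [← h]
  rw [Measure.map_map (by fun_prop) (by fun_prop)]
  congr 1
  ext x
  simp

/-- Each open half-space bounded by a hyperplane through the origin carries at most half of the
noise, by symmetry. -/
theorem noiseLaw_inner_pos_le_half {n : ℕ} (σ : ℝ) (f : EuclideanSpace ℝ (Fin n)) :
    noiseLaw n σ {x | 0 < ⟪f, x⟫} ≤ 1 / 2 := by
  have hm : MeasurableSet {x : EuclideanSpace ℝ (Fin n) | 0 < ⟪f, x⟫} :=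
    measurableSet_lt measurable_const (by fun_prop)
  have hm' : MeasurableSet {x : EuclideanSpace ℝ (Fin n) | ⟪f, x⟫ < 0} :=
    measurableSet_lt (by fun_prop) measurable_const
  have hsymm : noiseLaw n σ {x | 0 < ⟪f, x⟫} = noiseLaw n σ {x | ⟪f, x⟫ < 0} := by
    conv_lhs => rw [← noiseLaw_map_neg]
    rw [Measure.map_apply (by fun_prop) hm]
    congr 1
    ext x
    simp
  have hdisj : Disjoint {x : EuclideanSpace ℝ (Fin n) | 0 < ⟪f, x⟫} {x | ⟪f, x⟫ < 0} :=
    Set.disjoint_left.2 fun x (h1 : 0 < ⟪f, x⟫) (h2 : ⟪f, x⟫ < 0) => lt_asymm h1 h2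
  have h : noiseLaw n σ {x | 0 < ⟪f, x⟫} + noiseLaw n σ {x | 0 < ⟪f, x⟫} ≤ 1 := by
    conv_lhs => rw [hsymm]; arg 1; rw [← hsymm]
    rw [← measure_union hdisj hm']
    exact prob_le_one
  rw [ENNReal.le_div_iff_mul_le (by simp) (by simp), mul_two]
  exact h

theorem noiseLaw_sq_inner_ge_le {n : ℕ} (σ : ℝ) (u : EuclideanSpace ℝ (Fin n)) {s : ℝ}
    (hs : 0 < s) :
    noiseLaw n σ {x | s ≤ ⟪u, x⟫ ^ 2} ≤ ENNReal.ofReal (σ ^ 2 * ‖u‖ ^ 2 / s) := by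
  have hm : MeasurableSet {x : EuclideanSpace ℝ (Fin n) | s ≤ ⟪u, x⟫ ^ 2} :=
    measurableSet_le measurable_const (by fun_prop)
  rw [noiseLaw_eq_map_stdGaussian, Measure.map_apply (by fun_prop) hm]
  set L : StrongDual ℝ (EuclideanSpace ℝ (Fin n)) := innerSL ℝ (σ • u) with hL
  have hvar : Var[L; stdGaussian (EuclideanSpace ℝ (Fin n))] = σ ^ 2 * ‖u‖ ^ 2 := by
    rw [variance_dual_stdGaussian, hL, innerSL_apply_norm, norm_smul, mul_pow, Real.norm_eq_abs,
      sq_abs]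
  have hcheb := meas_ge_le_variance_div_sq (μ := stdGaussian (EuclideanSpace ℝ (Fin n)))
    (IsGaussian.memLp_dual _ L 2 (by simp)) (Real.sqrt_pos.2 hs)
  rw [hvar, Real.sq_sqrt hs.le, integral_strongDual_stdGaussian] at hcheb
  refine le_trans (measure_mono fun x hx => ?_) hcheb
  have hx' : s ≤ ⟪u, σ • x⟫ ^ 2 := hx
  have : L x = ⟪u, σ • x⟫ := by
    rw [hL, innerSL_apply_apply, real_inner_smul_left, real_inner_smul_right]
  simp only [Set.mem_ofPred_eq, sub_zero, this]
  exact (Real.sqrt_le_sqrt hx').trans_eq (Real.sqrt_sq_eq_abs _)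

/-! ### Testing many hypotheses -/

/-- A Gaussian shift by `f` inflates the probability of an event by at most `exp (‖f‖² / (2σ²))`,
up to an additive `1 / 2`: on the half-space `⟪f, y⟫ ≤ ‖f‖²`, which carries at least half of the
shifted law, the likelihood ratio is at most that number. -/
theorem obsLaw_le_exp_mul_noiseLaw_add_half {n : ℕ} {σ : ℝ} (hσ : 0 < σ)
    (f : EuclideanSpace ℝ (Fin n)) {B : Set (EuclideanSpace ℝ (Fin n))} (hB : MeasurableSet B) :
    obsLaw σ f B ≤
      ENNReal.ofReal (Real.exp (‖f‖ ^ 2 / 2 / σ ^ 2)) * noiseLaw n σ B + 1 / 2 := by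
  set H : Set (EuclideanSpace ℝ (Fin n)) := {y | ⟪f, y⟫ ≤ ‖f‖ ^ 2} with hH
  have hHm : MeasurableSet H := measurableSet_le (by fun_prop) measurable_const
  rw [← measure_inter_add_sdiff B hHm]
  refine add_le_add ?_ ?_
  · rw [obsLaw_eq_withDensity hσ, withDensity_apply _ (hB.inter hHm)]
    calc _ ≤ ∫⁻ _ in B ∩ H, ENNReal.ofReal (Real.exp (‖f‖ ^ 2 / 2 / σ ^ 2)) ∂noiseLaw n σ := by
          refine setLIntegral_mono' (hB.inter hHm) fun y hy => ?_
          have hy2 : ⟪f, y⟫ ≤ ‖f‖ ^ 2 := hy.2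
          refine ENNReal.ofReal_le_ofReal (Real.exp_le_exp.2 ?_)
          gcongr
          linarith
      _ = ENNReal.ofReal (Real.exp (‖f‖ ^ 2 / 2 / σ ^ 2)) * noiseLaw n σ (B ∩ H) :=
          setLIntegral_const _ _
      _ ≤ _ := by gcongr; exact Set.inter_subset_left
  · refine le_trans (measure_mono (Set.sdiff_subset_compl B H)) ?_
    rw [obsLaw, Measure.map_apply (by fun_prop) hHm.compl]
    refine le_trans (measure_mono fun x hx => ?_) (noiseLaw_inner_pos_le_half σ f)
    have hx' : ¬ ⟪f, f + x⟫ ≤ ‖f‖ ^ 2 := hx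
    rw [inner_add_right, real_inner_self_eq_norm_sq] at hx'
    have : 0 < ⟪f, x⟫ := by linarith
    exact this

/-- Among `M > 16` Gaussian shifts of squared length at most `σ² log M`, pairwise disjoint events
cannot all be likely: one of them has probability at most `3 / 4` under its shift. -/
theorem exists_obsLaw_le_of_disjoint {n M : ℕ} {σ : ℝ} (hσ : 0 < σ) (hM : 16 < M)
    (b : Fin M → EuclideanSpace ℝ (Fin n)) (hb : ∀ k, ‖b k‖ ^ 2 ≤ σ ^ 2 * Real.log M)
    {B : Fin M → Set (EuclideanSpace ℝ (Fin n))} (hB : ∀ k, MeasurableSet (B k))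
    (hd : Pairwise (Function.onFun Disjoint B)) :
    ∃ k, obsLaw σ (b k) (B k) ≤ ENNReal.ofReal (3 / 4) := by
  by_contra! hcon
  have hM0 : (0 : ℝ) < M := by exact_mod_cast (by omega : 0 < M)
  have hsum : ∑ k, noiseLaw n σ (B k) ≤ 1 := by
    rw [← tsum_fintype (L := .unconditional _), ← measure_iUnion hd hB]
    exact prob_le_one
  have hreal : ∑ k, (noiseLaw n σ).real (B k) ≤ 1 := by
    have := ENNReal.toReal_mono (by simp) hsum
    rwa [ENNReal.toReal_sum (fun k _ => measure_ne_top _ _), ENNReal.toReal_one] at this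
  have hk : ∀ k, 1 / 4 ≤ √M * (noiseLaw n σ).real (B k) := by
    intro k
    have h1 : ENNReal.ofReal (Real.exp (‖b k‖ ^ 2 / 2 / σ ^ 2)) ≤ ENNReal.ofReal √M := by
      refine ENNReal.ofReal_le_ofReal ?_
      rw [← Real.exp_log (Real.sqrt_pos.2 hM0), Real.log_sqrt hM0.le, Real.exp_le_exp,
        div_le_iff₀ (by positivity)]
      have := hb k
      linarith
    have h2 := (hcon k).le.trans ((obsLaw_le_exp_mul_noiseLaw_add_half hσ (b k) (hB k)).trans
      (add_le_add (mul_le_mul_left h1 _) le_rfl))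
    rw [← ofReal_measureReal (μ := noiseLaw n σ) (s := B k),
      ← ENNReal.ofReal_mul (Real.sqrt_nonneg _), show (1 / 2 : ℝ≥0∞) = ENNReal.ofReal (1 / 2) by
        rw [ENNReal.ofReal_div_of_pos (by norm_num)]; simp,
      ← ENNReal.ofReal_add (by positivity) (by norm_num),
      ENNReal.ofReal_le_ofReal_iff (by positivity)] at h2
    linarith
  have h4 : √M ≤ 4 := by
    have hs : ∑ _k : Fin M, (1 / 4 : ℝ) ≤ √M * 1 :=
      (Finset.sum_le_sum fun k _ => hk k).trans
        (by rw [← Finset.mul_sum]; exact mul_le_mul_of_nonneg_left hreal (Real.sqrt_nonneg _))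
    rw [Finset.sum_const, Finset.card_univ, Fintype.card_fin, nsmul_eq_mul, mul_one] at hs
    nlinarith [Real.sqrt_pos.2 hM0, Real.mul_self_sqrt hM0.le]
  have h16 : (16 : ℝ) < M := by exact_mod_cast hM
  nlinarith [Real.sqrt_nonneg (M : ℝ), Real.mul_self_sqrt hM0.le]

/-! ### Separated points on the sphere -/

/-- A unit vector far from given points exists as long as the points are few: otherwise the balls
of radius `1 / 2` around them would cover the shell `3 / 4 ≤ ‖x‖ < 1`, whose volume they do not
reach. -/
theorem exists_norm_eq_one_forall_le_dist {n M : ℕ}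
    (hM : (M : ℝ) * (1 / 2) ^ n + (3 / 4) ^ n < 1) (u : Fin M → EuclideanSpace ℝ (Fin n)) :
    ∃ w : EuclideanSpace ℝ (Fin n), ‖w‖ = 1 ∧ ∀ k, 1 / 4 ≤ dist w (u k) := by
  by_contra! hcon
  have hcover : Metric.ball (0 : EuclideanSpace ℝ (Fin n)) 1 ⊆
      (⋃ k, Metric.ball (u k) (1 / 2)) ∪ Metric.ball 0 (3 / 4) := by
    intro x hx
    rw [mem_ball_zero_iff] at hx
    rcases lt_or_ge ‖x‖ (3 / 4) with h | h
    · exact Or.inr (mem_ball_zero_iff.2 h)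
    · left
      have hx0 : ‖x‖ ≠ 0 := by linarith
      obtain ⟨k, hk⟩ := hcon (‖x‖⁻¹ • x) (by
        rw [norm_smul, norm_inv, norm_norm, inv_mul_cancel₀ hx0])
      have hproj : dist x (‖x‖⁻¹ • x) ≤ 1 / 4 := by
        have : x - ‖x‖⁻¹ • x = (1 - ‖x‖⁻¹) • x := by rw [sub_smul, one_smul]
        rw [dist_eq_norm, this, norm_smul, ← Real.norm_of_nonneg (norm_nonneg x), ← norm_mul,
          norm_norm, sub_mul, one_mul, inv_mul_cancel₀ hx0, Real.norm_eq_abs, abs_le]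
        constructor <;> linarith
      exact Set.mem_iUnion.2 ⟨k, Metric.mem_ball.2 (by
        linarith [dist_triangle x (‖x‖⁻¹ • x) (u k)])⟩
  set V := volume.real (Metric.ball (0 : EuclideanSpace ℝ (Fin n)) 1) with hV
  have hVpos : 0 < V := ENNReal.toReal_pos
    (Metric.measure_ball_pos _ _ one_pos).ne' measure_ball_lt_top.ne
  have hball : ∀ (x : EuclideanSpace ℝ (Fin n)) {r : ℝ}, 0 < r →
      volume.real (Metric.ball x r) = r ^ n * V := by
    intro x r hr
    rw [measureReal_def, Measure.addHaar_ball_of_pos _ _ hr, ENNReal.toReal_mul,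
      ENNReal.toReal_ofReal (by positivity), finrank_euclideanSpace_fin, hV, measureReal_def]
  have hfin : volume ((⋃ k, Metric.ball (u k) (1 / 2)) ∪
      Metric.ball (0 : EuclideanSpace ℝ (Fin n)) (3 / 4)) ≠ ⊤ :=
    measure_union_ne_top ((measure_iUnion_fintype_le _ _).trans_lt
      (ENNReal.sum_lt_top.2 fun _ _ => measure_ball_lt_top)).ne measure_ball_lt_top.ne
  have hle : V ≤ M * ((1 / 2) ^ n * V) + (3 / 4) ^ n * V := by
    calc V ≤ volume.real ((⋃ k, Metric.ball (u k) (1 / 2)) ∪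
          Metric.ball (0 : EuclideanSpace ℝ (Fin n)) (3 / 4)) := measureReal_mono hcover hfin
      _ ≤ (∑ k, volume.real (Metric.ball (u k) (1 / 2))) + volume.real (Metric.ball
          (0 : EuclideanSpace ℝ (Fin n)) (3 / 4)) :=
          (measureReal_union_le _ _).trans
            (add_le_add (measureReal_iUnion_fintype_le _) le_rfl)
      _ = _ := by
          simp_rw [hball _ (show (0 : ℝ) < 1 / 2 by norm_num),
            hball _ (show (0 : ℝ) < 3 / 4 by norm_num)]
          simp
  nlinarith

theorem exists_separated_unit_vectors {n M : ℕ}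
    (hM : (M : ℝ) * (1 / 2) ^ n + (3 / 4) ^ n < 1) :
    ∃ u : Fin M → EuclideanSpace ℝ (Fin n), (∀ k, ‖u k‖ = 1) ∧
      Pairwise fun k l => 1 / 4 ≤ dist (u k) (u l) := by
  induction M with
  | zero => exact ⟨Fin.elim0, fun k => k.elim0, fun k => k.elim0⟩
  | succ M ih =>
    have hM' : (M : ℝ) * (1 / 2) ^ n + (3 / 4) ^ n < 1 := by
      have : (0 : ℝ) < (1 / 2) ^ n := by positivity
      push_cast at hM
      linarith
    obtain ⟨u, hu, hsep⟩ := ih hM'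
    obtain ⟨w, hw, hwu⟩ := exists_norm_eq_one_forall_le_dist hM' u
    refine ⟨Fin.cons w u, fun k => ?_, fun k l hkl => ?_⟩
    · refine Fin.cases ?_ (fun i => ?_) k
      · simpa using hw
      · simpa using hu i
    · induction k using Fin.cases with
      | zero =>
        induction l using Fin.cases with
        | zero => exact absurd rfl hkl
        | succ j => simpa using hwu j
      | succ i =>
        induction l using Fin.cases with
        | zero => simpa [dist_comm] using hwu i
        | succ j => simpa using hsep (fun h => hkl (by rw [h]))

/-! ### Minimax lower bounds -/

/-- If each `b k` is estimated well, with high probability, by its own dictionary element when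
`b k` is the truth, then beating the dictionary amounts to identifying `k`, so the testing bound
gives a minimax lower bound. The separation makes the balls of squared radius `2 * t` around the
points `b k` disjoint. -/
theorem le_minimaxExcessProb_of_separated {n M : ℕ} {σ t : ℝ} (hσ : 0 < σ) (hM : 16 < M)
    (b : Fin M → EuclideanSpace ℝ (Fin n)) (hb : ∀ k, ‖b k‖ ^ 2 ≤ σ ^ 2 * Real.log M)
    (hsep : Pairwise fun k l => 8 * t ≤ dist (b k) (b l) ^ 2)
    (dict : Fin M → EuclideanSpace ℝ (Fin n) → EuclideanSpace ℝ (Fin n))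
    (hdict : ∀ k, obsLaw σ (b k) {y | t < ‖dict k y - b k‖ ^ 2} ≤ ENNReal.ofReal (1 / 8)) :
    ENNReal.ofReal (1 / 8) ≤ minimaxExcessProb σ dict t := by
  refine le_iInf₂ fun μ hμ => ?_
  set B : Fin M → Set (EuclideanSpace ℝ (Fin n)) := fun k => {y | ‖μ y - b k‖ ^ 2 < 2 * t} with hB
  have hBm : ∀ k, MeasurableSet (B k) := fun k =>
    measurableSet_lt (by fun_prop) measurable_const
  have hd : Pairwise (Function.onFun Disjoint B) := by
    intro k l hkl
    refine Set.disjoint_left.2 fun y (hk : ‖μ y - b k‖ ^ 2 < 2 * t)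
      (hl : ‖μ y - b l‖ ^ 2 < 2 * t) => ?_
    have h1 : 8 * t ≤ dist (b k) (b l) ^ 2 := hsep hkl
    have h2 := dist_triangle_left (b k) (b l) (μ y)
    rw [dist_eq_norm (μ y), dist_eq_norm (μ y)] at h2
    have h3 : dist (b k) (b l) ^ 2 ≤ (‖μ y - b k‖ + ‖μ y - b l‖) ^ 2 := by gcongr
    nlinarith [sq_nonneg (‖μ y - b k‖ - ‖μ y - b l‖)]
  obtain ⟨k, hk⟩ := exists_obsLaw_le_of_disjoint hσ hM b hb hBm hd
  refine le_trans ?_ (le_iSup _ (b k))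
  set G : Set (EuclideanSpace ℝ (Fin n)) :=
    {y | t ≤ ‖μ y - b k‖ ^ 2 - ⨅ k' : Fin M, ‖dict k' y - b k‖ ^ 2} with hG
  have hcover : Set.univ ⊆ (B k ∪ {y | t < ‖dict k y - b k‖ ^ 2}) ∪ G := by
    intro y _
    by_contra hy
    simp only [Set.mem_union, not_or] at hy
    obtain ⟨⟨hy1, hy2⟩, hy3⟩ := hy
    have hy1' : ¬ ‖μ y - b k‖ ^ 2 < 2 * t := hy1
    have hy2' : ¬ t < ‖dict k y - b k‖ ^ 2 := hy2
    have hinf : ⨅ k' : Fin M, ‖dict k' y - b k‖ ^ 2 ≤ ‖dict k y - b k‖ ^ 2 :=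
      ciInf_le (Set.finite_range _).bddBelow k
    exact hy3 (show t ≤ _ by linarith)
  have htotal : 1 ≤ ENNReal.ofReal (3 / 4) + ENNReal.ofReal (1 / 8) + obsLaw σ (b k) G := by
    rw [← measure_univ (μ := obsLaw σ (b k))]
    refine (measure_mono hcover).trans ((measure_union_le _ _).trans ?_)
    gcongr
    exact (measure_union_le _ _).trans (add_le_add hk (hdict k))
  rw [← ENNReal.ofReal_add (by norm_num) (by norm_num),
    ← ofReal_measureReal (μ := obsLaw σ (b k)) (s := G),
    ← ENNReal.ofReal_add (by norm_num) measureReal_nonneg, ENNReal.one_le_ofReal] at htotal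
  rw [← ofReal_measureReal (μ := obsLaw σ (b k)) (s := G)]
  exact ENNReal.ofReal_le_ofReal (by linarith)

/-! ### Rank-one orthoprojectors -/

theorem applyMatrix_vecMulVec {n : ℕ} (u y : EuclideanSpace ℝ (Fin n)) :
    applyMatrix (Matrix.vecMulVec u.ofLp u.ofLp) y = ⟪u, y⟫ • u := by
  ext i
  simp [applyMatrix, Matrix.vecMulVec_mulVec, PiLp.inner_apply, dotProduct, mul_comm]

theorem isOrthoprojector_vecMulVec {n : ℕ} {u : EuclideanSpace ℝ (Fin n)} (hu : ‖u‖ = 1) :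
    IsOrthoprojector (Matrix.vecMulVec u.ofLp u.ofLp) := by
  have huu : u.ofLp ⬝ᵥ u.ofLp = 1 := by
    have := EuclideanSpace.real_norm_sq_eq u
    rw [hu] at this
    simp only [dotProduct, ← sq]
    linarith
  refine ⟨(Matrix.transpose_vecMulVec _ _).symm, ?_⟩
  rw [Matrix.transpose_vecMulVec, sq, Matrix.vecMulVec_mul_vecMulVec, huu, one_smul]

theorem rank_vecMulVec_self {n : ℕ} {u : EuclideanSpace ℝ (Fin n)} (hu : ‖u‖ = 1) :
    (Matrix.vecMulVec u.ofLp u.ofLp).rank = 1 := by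
  refine le_antisymm (Matrix.rank_vecMulVec_le _ _) (Nat.one_le_iff_ne_zero.2 fun h => ?_)
  rw [Matrix.rank, Submodule.finrank_eq_zero, LinearMap.range_eq_bot, ← Matrix.toLin'_apply',
    LinearEquiv.map_eq_zero_iff, Matrix.vecMulVec_eq_zero, or_self] at h
  have : u = 0 := by ext i; exact congrFun h i
  simp [this] at hu

/-- When the truth lies on the line spanned by a unit vector `u`, the projection of the data onto
that line errs only by the noise component along `u`. -/
theorem obsLaw_projection_loss_gt_le {n : ℕ} (σ : ℝ) {u : EuclideanSpace ℝ (Fin n)}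
    (hu : ‖u‖ = 1) (r : ℝ) {t : ℝ} (ht : 0 < t) :
    obsLaw σ (r • u)
        {y | t < ‖applyMatrix (Matrix.vecMulVec u.ofLp u.ofLp) y - r • u‖ ^ 2} ≤
      ENNReal.ofReal (σ ^ 2 / t) := by
  simp_rw [applyMatrix_vecMulVec]
  have hm : MeasurableSet {y : EuclideanSpace ℝ (Fin n) | t < ‖⟪u, y⟫ • u - r • u‖ ^ 2} :=
    measurableSet_lt measurable_const (by fun_prop)
  rw [obsLaw, Measure.map_apply (by fun_prop) hm]
  have hcheb := noiseLaw_sq_inner_ge_le σ u ht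
  rw [hu, one_pow, mul_one] at hcheb
  refine le_trans (measure_mono fun x hx => ?_) hcheb
  have hx' : t < ‖⟪u, r • u + x⟫ • u - r • u‖ ^ 2 := hx
  rw [← sub_smul, norm_smul, hu, mul_one, inner_add_right, real_inner_smul_right,
    real_inner_self_eq_norm_sq, hu, one_pow, mul_one, add_sub_cancel_left, Real.norm_eq_abs,
    sq_abs] at hx'
  exact hx'.le

/-! ### Choice of the constants -/

/-- The volume condition for separated unit vectors, from `exp (1 / 128) ≤ 3 / 2`. -/
theorem mul_half_pow_add_lt_one {n M : ℕ} (hM : 0 < M) (hn : 3 ≤ n)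
    (h : Real.log M ≤ 1 / 128 * n) : (M : ℝ) * (1 / 2) ^ n + (3 / 4) ^ n < 1 := by
  have hexp : Real.exp (1 / 128) ≤ 3 / 2 := by
    have := Real.exp_bound_div_one_sub_of_interval' (x := 1 / 128) (by norm_num) (by norm_num)
    norm_num at this ⊢
    linarith
  have hMle : (M : ℝ) ≤ (3 / 2) ^ n := by
    rw [← Real.exp_log (by exact_mod_cast hM : (0 : ℝ) < M)]
    calc Real.exp (Real.log M) ≤ Real.exp (n * (1 / 128)) := Real.exp_le_exp.2 (by linarith)
      _ = Real.exp (1 / 128) ^ n := Real.exp_nat_mul _ _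
      _ ≤ (3 / 2) ^ n := by gcongr
  have h1 : (M : ℝ) * (1 / 2) ^ n ≤ (3 / 4) ^ n := by
    calc (M : ℝ) * (1 / 2) ^ n ≤ (3 / 2) ^ n * (1 / 2) ^ n := by gcongr
      _ = (3 / 4) ^ n := by rw [← mul_pow]; norm_num
  have h2 : (3 / 4 : ℝ) ^ n ≤ (3 / 4) ^ 3 := pow_le_pow_of_le_one (by norm_num) (by norm_num) hn
  norm_num at h2
  linarith

theorem mainTheorem2 :
    ∃ c C p : ℝ, 0 < c ∧ 0 < C ∧ 0 < p ∧
      ∀ M n : ℕ, C ≤ (M : ℝ) → C ≤ (n : ℝ) → Real.log (M : ℝ) ≤ c * (n : ℝ) →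
        ∀ σ : ℝ, 0 < σ →
          ∃ (b : Fin M → EuclideanSpace ℝ (Fin n))
            (A : Fin M → Matrix (Fin n) (Fin n) ℝ),
            (∀ k, IsOrthoprojector (A k) ∧ (A k).rank = 1) ∧
            ENNReal.ofReal p ≤
              minimaxExcessProb σ (fun k _ => b k) (c * σ ^ 2 * Real.log (M : ℝ)) ∧
            ENNReal.ofReal p ≤
              minimaxExcessProb σ (fun k y => applyMatrix (A k) y)
                (c * σ ^ 2 * Real.log (M : ℝ)) := by
  -- With signals of squared length `σ² log M`, separation `1 / 4` of the directions allows
  -- `8 * c ≤ (1 / 4) ^ 2`; Chebyshev's bound `1 / (c log M) ≤ 1 / 8` then asks for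
  -- `log M ≥ 8 * 128`.
  refine ⟨1 / 128, Real.exp 1024, 1 / 8, by norm_num, Real.exp_pos _, by norm_num, ?_⟩
  intro M n hCM hCn hlog σ hσ
  have hC : (1024 : ℝ) + 1 ≤ Real.exp 1024 := Real.add_one_le_exp _
  have hMr : (16 : ℝ) < M := by linarith
  have hnr : (3 : ℝ) ≤ n := by linarith
  have hM : 16 < M := by exact_mod_cast hMr
  have hL : 1024 ≤ Real.log M := (Real.le_log_iff_exp_le (by linarith)).2 hCM
  obtain ⟨u, hu, hsep⟩ := exists_separated_unit_vectors
    (mul_half_pow_add_lt_one (by omega : 0 < M) (by exact_mod_cast hnr) hlog)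
  set r : ℝ := σ * √(Real.log M) with hr
  have hr2 : r ^ 2 = σ ^ 2 * Real.log M := by rw [hr, mul_pow, Real.sq_sqrt (by linarith)]
  have hσ2 : 0 < σ ^ 2 := by positivity
  have ht : 0 < 1 / 128 * σ ^ 2 * Real.log M := by positivity
  have hb : ∀ k, ‖r • u k‖ ^ 2 ≤ σ ^ 2 * Real.log M := fun k => by
    rw [norm_smul, hu, mul_one, Real.norm_eq_abs, sq_abs, hr2]
  have hbsep : Pairwise fun k l =>
      8 * (1 / 128 * σ ^ 2 * Real.log M) ≤ dist (r • u k) (r • u l) ^ 2 := by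
    intro k l hkl
    have h1 : (1 / 4) ^ 2 ≤ dist (u k) (u l) ^ 2 := pow_le_pow_left₀ (by norm_num) (hsep hkl) 2
    rw [dist_smul₀, mul_pow, Real.norm_eq_abs, sq_abs, hr2]
    nlinarith [mul_le_mul_of_nonneg_left h1 (by positivity : 0 ≤ σ ^ 2 * Real.log M)]
  refine ⟨fun k => r • u k, fun k => Matrix.vecMulVec (u k).ofLp (u k).ofLp,
    fun k => ⟨isOrthoprojector_vecMulVec (hu k), rank_vecMulVec_self (hu k)⟩, ?_, ?_⟩
  · refine le_minimaxExcessProb_of_separated hσ hM _ hb hbsep _ fun k => ?_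
    have hempty : {y : EuclideanSpace ℝ (Fin n) |
        1 / 128 * σ ^ 2 * Real.log M < ‖r • u k - r • u k‖ ^ 2} = ∅ := by
      ext y
      simpa using ht.le
    rw [hempty, measure_empty]
    exact zero_le
  · refine le_minimaxExcessProb_of_separated hσ hM _ hb hbsep _ fun k => ?_
    refine (obsLaw_projection_loss_gt_le σ (hu k) r ht).trans (ENNReal.ofReal_le_ofReal ?_)
    rw [div_le_iff₀ ht]
    nlinarith
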